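/- Let $F$ be an arbitrary field, and let $\mathbb{O}(F)$ be the split octonion algebra over $F$, realized as the $8$-dimensional space of Zorn vector matrices $x=\begin{pmatrix} a & \alpha\\ \beta & b\end{pmatrix}$ with $a,b\in F$ and $\alpha,\beta\in F^3$, with the multiplication $$\begin{pmatrix} a & \alpha\\ \beta & b\end{pmatrix}\begin{pmatrix} c & \gamma\\ \delta & d\end{pmatrix}=\begin{pmatrix} ac+\alpha\cdot\delta & a\gamma+d\alpha-\beta\times\delta\\ c\beta+b\delta+\alpha\times\gamma & \beta\cdot\gamma+bd\end{pmatrix}$$ (where $\cdot$ and $\times$ are the usual dot and vector products on $F^3$) and the quadratic form (norm) $N(x)=ab-\alpha\cdot\beta$. Let $M(F)=\{x\in\mathbb{O}(F): N(x)=1\}$, which is a loop under this multiplication. Let $\mathrm{Mlt}(M(F))$ be its multiplication group, that is, the group of permutations of $M(F)$ generated by all left translations $L_a: x\mapsto ax$ and all right translations $R_a: x\mapsto xa$, $a\in M(F)$. Let $O(\mathbb{O}(F),N)$ be the group of invertible linear maps of $\mathbb{O}(F)$ preserving $N$, and let $\Omega(\mathbb{O}(F),N)$ be its commutator subgroup.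 Then $\mathrm{Mlt}(M(F))=\Omega(\mathbb{O}(F),N)$, where an orthogonal transformation is identified with the permutation of $M(F)$ that it induces. Precisely: the homomorphism $g\mapsto g|_{M(F)}$ from $O(\mathbb{O}(F),N)$ to the group of permutations of $M(F)$ is injective, and it maps $\Omega(\mathbb{O}(F),N)$ onto $\mathrm{Mlt}(M(F))$. -/

import Mathlib

open scoped Matrix

/-- A loop: a set with a binary operation and a two-sided neutral element, such that all left
and all right translations are bijective. -/
class AlgLoop (Q : Type*) extends MulOneClass Q where
  left_bijective : ∀ a : Q, Function.Bijective (fun x : Q => a * x)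
  right_bijective : ∀ a : Q, Function.Bijective (fun x : Q => x * a)

namespace AlgLoop

variable {Q : Type*} [AlgLoop Q]

/-- The left translation `x ↦ a * x` as a permutation. -/
noncomputable def leftTranslation (a : Q) : Equiv.Perm Q :=
  Equiv.ofBijective (fun x => a * x) (left_bijective a)

/-- The right translation `x ↦ x * a` as a permutation. -/
noncomputable def rightTranslation (a : Q) : Equiv.Perm Q :=
  Equiv.ofBijective (fun x => x * a) (right_bijective a)

variable (Q) in
/-- The multiplication group: the permutation group generated by all left and right
translations. -/
noncomputable def multiplicationGroup : Subgroup (Equiv.Perm Q) :=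
  Subgroup.closure
    (Set.range (leftTranslation : Q → Equiv.Perm Q) ∪
      Set.range (rightTranslation : Q → Equiv.Perm Q))

end AlgLoop

namespace QuadraticForm

variable {F V : Type*} [Field F] [AddCommGroup V] [Module F V]

/-- The orthogonal group of a quadratic form `N`: all invertible linear maps preserving `N`. -/
def orthogonalGroup (N : QuadraticForm F V) : Subgroup (V ≃ₗ[F] V) where
  carrier := {g | ∀ x, N (g x) = N x}
  one_mem' := fun _ => rfl
  mul_mem' := by
    intro g h hg hh x
    exact (hg (h x)).trans (hh x)
  inv_mem' := by
    intro g hg x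
    have h := hg (g⁻¹ x)
    rw [← LinearEquiv.mul_apply, mul_inv_cancel] at h
    exact h.symm

/-- `Ω(V, N)`: the commutator subgroup of the orthogonal group of `N`. -/
def omegaGroup (N : QuadraticForm F V) : Subgroup (orthogonalGroup N) :=
  commutator (orthogonalGroup N)

/-- Every orthogonal transformation permutes the vectors of norm one. -/
def restrictNormOne (N : QuadraticForm F V) :
    orthogonalGroup N →* Equiv.Perm {x : V // N x = 1} where
  toFun g := Equiv.Perm.subtypePerm (g : V ≃ₗ[F] V).toEquiv (fun x => by
    have h : N ((g : V ≃ₗ[F] V) x) = N x := g.2 x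
    show N ((g : V ≃ₗ[F] V) x) = 1 ↔ N x = 1
    rw [h])
  map_one' := rfl
  map_mul' _ _ := rfl

end QuadraticForm

/-- Zorn vector matrices: `a`, `b` are the diagonal scalars, `α` (upper right) and `β`
(lower left) are vectors in `F³`. -/
@[ext]
structure Zorn (F : Type*) where
  a : F
  α : Fin 3 → F
  β : Fin 3 → F
  b : F

namespace Zorn

variable {F : Type*} [Field F]

instance : Zero (Zorn F) := ⟨⟨0, 0, 0, 0⟩⟩
instance : One (Zorn F) := ⟨⟨1, 0, 0, 1⟩⟩
instance : Add (Zorn F) := ⟨fun x y => ⟨x.a + y.a, x.α + y.α, x.β + y.β, x.b + y.b⟩⟩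
instance : Neg (Zorn F) := ⟨fun x => ⟨-x.a, -x.α, -x.β, -x.b⟩⟩
instance : SMul F (Zorn F) := ⟨fun c x => ⟨c * x.a, c • x.α, c • x.β, c * x.b⟩⟩

/-- Zorn's multiplication of vector matrices. -/
instance : Mul (Zorn F) :=
  ⟨fun x y =>
    ⟨x.a * y.a + x.α ⬝ᵥ y.β,
      x.a • y.α + y.b • x.α - x.β ⨯₃ y.β,
      y.a • x.β + x.b • y.β + x.α ⨯₃ y.α,
      x.β ⬝ᵥ y.α + x.b * y.b⟩⟩

@[simp] lemma zero_a : (0 : Zorn F).a = 0 := rfl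
@[simp] lemma zero_α : (0 : Zorn F).α = 0 := rfl
@[simp] lemma zero_β : (0 : Zorn F).β = 0 := rfl
@[simp] lemma zero_b : (0 : Zorn F).b = 0 := rfl
@[simp] lemma one_a : (1 : Zorn F).a = 1 := rfl
@[simp] lemma one_α : (1 : Zorn F).α = 0 := rfl
@[simp] lemma one_β : (1 : Zorn F).β = 0 := rfl
@[simp] lemma one_b : (1 : Zorn F).b = 1 := rfl
@[simp] lemma add_a (x y : Zorn F) : (x + y).a = x.a + y.a := rfl
@[simp] lemma add_α (x y : Zorn F) : (x + y).α = x.α + y.α := rfl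
@[simp] lemma add_β (x y : Zorn F) : (x + y).β = x.β + y.β := rfl
@[simp] lemma add_b (x y : Zorn F) : (x + y).b = x.b + y.b := rfl
@[simp] lemma neg_a (x : Zorn F) : (-x).a = -x.a := rfl
@[simp] lemma neg_α (x : Zorn F) : (-x).α = -x.α := rfl
@[simp] lemma neg_β (x : Zorn F) : (-x).β = -x.β := rfl
@[simp] lemma neg_b (x : Zorn F) : (-x).b = -x.b := rfl
@[simp] lemma smul_a (c : F) (x : Zorn F) : (c • x).a = c * x.a := rfl
@[simp] lemma smul_α (c : F) (x : Zorn F) : (c • x).α = c • x.α := rfl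
@[simp] lemma smul_β (c : F) (x : Zorn F) : (c • x).β = c • x.β := rfl
@[simp] lemma smul_b (c : F) (x : Zorn F) : (c • x).b = c * x.b := rfl
@[simp] lemma mul_a (x y : Zorn F) : (x * y).a = x.a * y.a + x.α ⬝ᵥ y.β := rfl
@[simp] lemma mul_α (x y : Zorn F) :
    (x * y).α = x.a • y.α + y.b • x.α - x.β ⨯₃ y.β := rfl
@[simp] lemma mul_β (x y : Zorn F) :
    (x * y).β = y.a • x.β + x.b • y.β + x.α ⨯₃ y.α := rfl
@[simp] lemma mul_b (x y : Zorn F) : (x * y).b = x.β ⬝ᵥ y.α + x.b * y.b := rfl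

instance : AddCommGroup (Zorn F) where
  add_assoc x y z := by ext <;> simp [add_assoc]
  zero_add x := by ext <;> simp
  add_zero x := by ext <;> simp
  add_comm x y := by ext <;> simp [add_comm]
  neg_add_cancel x := by ext <;> simp
  nsmul := nsmulRec
  zsmul := zsmulRec

instance : Module F (Zorn F) where
  one_smul x := by ext <;> simp
  mul_smul c d x := by ext <;> simp [mul_assoc]
  smul_zero c := by ext <;> simp
  smul_add c x y := by ext <;> simp [mul_add]
  add_smul c d x := by ext <;> simp [add_mul]
  zero_smul x := by ext <;> simp

lemma cross_zero' (v w : Fin 3 → F) : (v ⨯₃ w) 0 = v 1 * w 2 - v 2 * w 1 := by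
  simp [cross_apply]

lemma cross_one' (v w : Fin 3 → F) : (v ⨯₃ w) 1 = v 2 * w 0 - v 0 * w 2 := by
  simp [cross_apply]

lemma cross_two' (v w : Fin 3 → F) : (v ⨯₃ w) 2 = v 0 * w 1 - v 1 * w 0 := by
  simp [cross_apply]

/-- The bilinear form `⟨x, y⟩ = N (x + y) - N x - N y` associated with the norm. -/
def polarForm : LinearMap.BilinMap F (Zorn F) F :=
  LinearMap.mk₂ F (fun x y => x.a * y.b + y.a * x.b - x.α ⬝ᵥ y.β - y.α ⬝ᵥ x.β)
    (fun x y z => by simp; ring)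
    (fun c x y => by simp; ring)
    (fun x y z => by simp; ring)
    (fun c x y => by simp; ring)

variable (F) in
/-- The norm `N x = det x = a b - α · β`. -/
def norm : QuadraticForm F (Zorn F) where
  toFun x := x.a * x.b - x.α ⬝ᵥ x.β
  toFun_smul c x := by simp; ring
  exists_companion' := ⟨polarForm, fun x y => by simp [polarForm]; ring⟩

lemma norm_apply (x : Zorn F) : norm F x = x.a * x.b - x.α ⬝ᵥ x.β := rfl

/-- The conjugate of a vector matrix. -/
def conj (x : Zorn F) : Zorn F := ⟨x.b, -x.α, -x.β, x.a⟩

lemma norm_one : norm F 1 = 1 := by simp [norm_apply]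

lemma norm_mul (x y : Zorn F) : norm F (x * y) = norm F x * norm F y := by
  simp [norm_apply, Matrix.vec3_dotProduct, cross_zero', cross_one', cross_two']
  ring

lemma norm_conj (x : Zorn F) : norm F (conj x) = norm F x := by
  simp [norm_apply, conj]
  ring

lemma one_mul' (x : Zorn F) : 1 * x = x := by ext <;> simp

lemma mul_one' (x : Zorn F) : x * 1 = x := by ext <;> simp

lemma conj_mul_mul (x y : Zorn F) : conj x * (x * y) = norm F x • y := by
  ext i <;> (try fin_cases i) <;>
    simp [norm_apply, conj, Matrix.vec3_dotProduct, cross_zero', cross_one', cross_two'] <;> ring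

lemma mul_conj_mul (x y : Zorn F) : x * (conj x * y) = norm F x • y := by
  ext i <;> (try fin_cases i) <;>
    simp [norm_apply, conj, Matrix.vec3_dotProduct, cross_zero', cross_one', cross_two'] <;> ring

lemma mul_mul_conj (x y : Zorn F) : (y * x) * conj x = norm F x • y := by
  ext i <;> (try fin_cases i) <;>
    simp [norm_apply, conj, Matrix.vec3_dotProduct, cross_zero', cross_one', cross_two'] <;> ring

lemma mul_conj_mul' (x y : Zorn F) : (y * conj x) * x = norm F x • y := by
  ext i <;> (try fin_cases i) <;>
    simp [norm_apply, conj, Matrix.vec3_dotProduct, cross_zero', cross_one', cross_two'] <;> ring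

variable (F) in
/-- `M(F)`: the vector matrices of norm one. -/
abbrev NormOne : Type _ := {x : Zorn F // norm F x = 1}

/-- `M(F)` is a loop under Zorn's multiplication. -/
instance : AlgLoop (NormOne F) where
  one := ⟨1, norm_one⟩
  mul x y := ⟨x.1 * y.1, by rw [norm_mul, x.2, y.2, mul_one]⟩
  one_mul x := Subtype.ext (one_mul' x.1)
  mul_one x := Subtype.ext (mul_one' x.1)
  left_bijective x := by
    refine Function.bijective_iff_has_inverse.mpr
      ⟨fun y => ⟨conj x.1 * y.1, by rw [norm_mul, norm_conj, x.2, y.2, mul_one]⟩, ?_, ?_⟩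
    · intro y
      refine Subtype.ext ((conj_mul_mul x.1 y.1).trans ?_)
      rw [x.2, one_smul]
    · intro y
      refine Subtype.ext ((mul_conj_mul x.1 y.1).trans ?_)
      rw [x.2, one_smul]
  right_bijective x := by
    refine Function.bijective_iff_has_inverse.mpr
      ⟨fun y => ⟨y.1 * conj x.1, by rw [norm_mul, norm_conj, x.2, y.2, mul_one]⟩, ?_, ?_⟩
    · intro y
      refine Subtype.ext ((mul_mul_conj x.1 y.1).trans ?_)
      rw [x.2, one_smul]
    · intro y
      refine Subtype.ext ((mul_conj_mul' x.1 y.1).trans ?_)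
      rw [x.2, one_smul]

end Zorn

/-! ### Reflections in vectors of norm one -/

namespace QuadraticForm

open _root_.QuadraticMap

variable {F V : Type*} [Field F] [AddCommGroup V] [Module F V] {N : QuadraticForm F V}

/-! Write `s_a` for the reflection in a vector `a` of norm one, and `E` for the group generated by
the products `s_a s_b`. Both the commutator subgroup of `O(N)` and the group generated by the
multiplications `L_a`, `R_a` turn out to equal `E`. Only reflections in vectors of norm one occur,
so no division by 2 or by a norm is needed and every field is allowed.

`[O, O] ≤ E` (`IsHyperbolicBasis.commutator_le_even`): modulo such reflections, every orthogonal map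
only scales one fixed hyperbolic pair. These scalings commute, and reflections become central modulo
`E`, so `O/E` is abelian. The reduction is of Witt type: singular vectors are moved by reflections,
and their partners by Siegel transformations, which lie in `E`.

`E ≤ [O, O]` and `E ≤ ⟨L_a, R_a⟩`: `s_1` is `x ↦ -conj x`, and `s_a s_1` is both `[L_a, s_1]` and
`L_a R_a`.

`⟨L_a, R_a⟩ ≤ E` (`leftMul_mem`): `L_a` for unitriangular `a` is a product of Siegel
transformations, and the middle Moufang identity carries this over to all `a`. -/

lemma map_add_eq (x y : V) : N (x + y) = N x + N y + polar N x y :=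
  QuadraticMap.map_add N x y

lemma map_sub_eq (x y : V) : N (x - y) = N x + N y - polar N x y := by
  have h := QuadraticMap.map_add N x (-y)
  rw [QuadraticMap.map_neg, polar_neg_right] at h
  rw [sub_eq_add_neg, h]
  ring

lemma polar_self' (x : V) : polar N x x = 2 * N x := by
  rw [QuadraticMap.polar_self]
  simp

lemma polar_map (g : orthogonalGroup N) (x y : V) : polar N (g.1 x) (g.1 y) = polar N x y := by
  have h : ∀ z, N (g.1 z) = N z := g.2
  simp only [polar, ← map_add, h]

/-- The reflection in the hyperplane orthogonal to a vector of norm one. -/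
def reflection (N : QuadraticForm F V) (a : {a : V // N a = 1}) : orthogonalGroup N where
  val := LinearEquiv.ofInvolutive
    (LinearMap.id - (polarBilin N a.1).smulRight a.1) (fun x => by
      simp only [LinearMap.sub_apply, LinearMap.id_apply, LinearMap.smulRight_apply,
        polarBilin_apply_apply, polar_sub_right, polar_smul_right, polar_self', a.2, smul_eq_mul]
      module)
  property x := by
    change N (x - polar N a.1 x • a.1) = N x
    rw [map_sub_eq, QuadraticMap.map_smul, polar_smul_right, a.2, polar_comm N x]
    simp

lemma reflection_apply (a : {a : V // N a = 1}) (x : V) :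
    (reflection N a).1 x = x - polar N a.1 x • a.1 := rfl

lemma reflection_mul_self (a : {a : V // N a = 1}) : reflection N a * reflection N a = 1 := by
  refine Subtype.ext (LinearEquiv.ext fun x => ?_)
  exact LinearEquiv.symm_apply_apply (reflection N a).1 x

lemma reflection_inv (a : {a : V // N a = 1}) : (reflection N a)⁻¹ = reflection N a :=
  inv_eq_of_mul_eq_one_left (reflection_mul_self a)

lemma mul_reflection (g : orthogonalGroup N) (a : {a : V // N a = 1}) :
    g * reflection N a = reflection N (restrictNormOne N g a) * g := by
  refine Subtype.ext (LinearEquiv.ext fun x => ?_)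
  change g.1 (x - polar N a.1 x • a.1) = g.1 x - polar N (g.1 a.1) (g.1 x) • g.1 a.1
  rw [polar_map, map_sub, map_smul]

variable (N) in
/-- The group generated by the reflections in vectors of norm one. -/
def reflectionGroup : Subgroup (orthogonalGroup N) :=
  Subgroup.closure (Set.range (reflection N))

variable (N) in
/-- The group generated by products of two reflections in vectors of norm one. -/
def evenReflectionGroup : Subgroup (orthogonalGroup N) :=
  Subgroup.closure {g | ∃ a b, g = reflection N a * reflection N b}

lemma reflection_mem (a : {a : V // N a = 1}) : reflection N a ∈ reflectionGroup N :=
  Subgroup.subset_closure ⟨a, rfl⟩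

lemma reflection_mul_mem (a b : {a : V // N a = 1}) :
    reflection N a * reflection N b ∈ evenReflectionGroup N :=
  Subgroup.subset_closure ⟨a, b, rfl⟩

lemma even_le : evenReflectionGroup N ≤ reflectionGroup N := by
  refine (Subgroup.closure_le _).2 ?_
  rintro _ ⟨a, b, rfl⟩
  exact mul_mem (reflection_mem a) (reflection_mem b)

lemma conj_reflection (g : orthogonalGroup N) (a : {a : V // N a = 1}) :
    g * reflection N a * g⁻¹ = reflection N (restrictNormOne N g a) := by
  rw [mul_reflection, mul_inv_cancel_right]

instance evenReflectionGroup_normal : (evenReflectionGroup N).Normal where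
  conj_mem r hr g := by
    induction hr using Subgroup.closure_induction with
    | mem r hr =>
      obtain ⟨a, b, rfl⟩ := hr
      rw [← conj_mul, conj_reflection, conj_reflection]
      exact reflection_mul_mem _ _
    | one => simp
    | mul r s _ _ hr hs => rw [← conj_mul]; exact mul_mem hr hs
    | inv r _ hr => rw [← conj_inv]; exact inv_mem hr

/-! ### Siegel transformations and hyperbolic bases -/

/-- The formula of the Siegel transformation attached to a singular vector `u` and a vector `v`
orthogonal to it. -/
def siegel (N : QuadraticForm F V) (u v x : V) : V :=
  x + polar N x v • u - polar N x u • v - (N v * polar N x u) • u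

/-- The pairing of `v` with the term `-⟨x, u⟩ w` supplies the `⟨v, w⟩` that completes `N v + N w` to
`N (v + w)`. -/
lemma siegel_siegel {u v w : V} (hu : N u = 0) (hv : polar N v u = 0) (hw : polar N w u = 0)
    (x : V) : siegel N u v (siegel N u w x) = siegel N u (v + w) x := by
  have hv' : polar N u v = 0 := by rw [polar_comm, hv]
  simp only [siegel, polar_add_left, polar_sub_left, polar_smul_left, polar_add_right,
    polar_self', hu, hv', hw, QuadraticMap.map_add N v w, polar_comm N w v, smul_eq_mul]
  module

/-- A map is realised by a product of an even number of reflections in vectors of norm one. -/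
def IsEven (N : QuadraticForm F V) (φ : V → V) : Prop :=
  ∃ r ∈ evenReflectionGroup N, ∀ x, r.1 x = φ x

/-- The vector `v + u` also has norm one, and the transformation is `s_{v+u} s_v`. -/
lemma isEven_siegel_of_norm_one {u v : V} (hu : N u = 0) (hv : polar N v u = 0) (h1 : N v = 1) :
    IsEven N (siegel N u v) := by
  have h2 : N (v + u) = 1 := by rw [map_add_eq, hu, hv, h1]; ring
  refine ⟨_, reflection_mul_mem ⟨v + u, h2⟩ ⟨v, h1⟩, fun x => ?_⟩
  change (reflection N ⟨v + u, h2⟩).1 ((reflection N ⟨v, h1⟩).1 x) = _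
  simp only [reflection_apply, siegel, polar_add_left, polar_sub_right, polar_smul_right,
    polar_self', h1, polar_comm N u, hv, polar_comm N v x, smul_eq_mul]
  module

lemma isEven_siegel_add {u v w : V} (hu : N u = 0) (hv : polar N v u = 0) (hw : polar N w u = 0)
    (h1 : IsEven N (siegel N u v)) (h2 : IsEven N (siegel N u w)) :
    IsEven N (siegel N u (v + w)) := by
  obtain ⟨r, hr, h⟩ := h1
  obtain ⟨s, hs, h'⟩ := h2
  refine ⟨r * s, mul_mem hr hs, fun x => ?_⟩
  change r.1 (s.1 x) = _
  rw [h', h, siegel_siegel hu hv hw]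

/-- Additivity in `v` reduces this to `v + a` and `-a`, both of norm one. -/
lemma isEven_siegel_of_orthogonal {u v a : V} (hu : N u = 0) (hv : N v = 0)
    (hvu : polar N v u = 0) (ha : N a = 1) (hau : polar N a u = 0) (hav : polar N a v = 0) :
    IsEven N (siegel N u v) := by
  have h : v = (v + a) + -a := by abel
  have hau' : polar N (-a) u = 0 := by rw [polar_neg_left, hau, neg_zero]
  have hva : polar N (v + a) u = 0 := by rw [polar_add_left, hau, hvu, add_zero]
  rw [h]
  refine isEven_siegel_add hu hva hau' (isEven_siegel_of_norm_one hu hva ?_)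
    (isEven_siegel_of_norm_one hu hau' ?_)
  · rw [map_add_eq, hv, ha, polar_comm, hav]; ring
  · rw [QuadraticMap.map_neg, ha]

/-- The vectors `e i`, `f i` form a basis of hyperbolic pairs. -/
structure IsHyperbolicBasis (N : QuadraticForm F V) {ι : Type*} [Fintype ι] (e f : ι → V) :
    Prop where
  left : ∀ i, N (e i) = 0
  right : ∀ i, N (f i) = 0
  left_left : ∀ i j, polar N (e i) (e j) = 0
  right_right : ∀ i j, polar N (f i) (f j) = 0
  pair : ∀ i, polar N (e i) (f i) = 1
  left_right : ∀ i j, i ≠ j → polar N (e i) (f j) = 0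
  sum : ∀ x, x = ∑ i, (polar N x (f i) • e i + polar N x (e i) • f i)

namespace IsHyperbolicBasis

variable {ι : Type*} [Fintype ι] {e f : ι → V}

lemma symm (h : IsHyperbolicBasis N e f) : IsHyperbolicBasis N f e where
  left := h.right
  right := h.left
  left_left := h.right_right
  right_right := h.left_left
  pair i := by rw [polar_comm, h.pair]
  left_right i j hij := by rw [polar_comm, h.left_right j i hij.symm]
  sum x := by
    conv_lhs => rw [h.sum x]
    exact Finset.sum_congr rfl fun i _ => add_comm _ _

/-- A third hyperbolic pair provides the auxiliary vector `e k + f k`, of norm one and orthogonal to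
everything involved. -/
lemma isEven_siegel_left (h : IsHyperbolicBasis N e f) (hι : ∀ i j : ι, ∃ k, k ≠ i ∧ k ≠ j)
    (j i : ι) (t : F) : IsEven N (siegel N (e j) (t • e i)) := by
  obtain ⟨k, hki, hkj⟩ := hι i j
  refine isEven_siegel_of_orthogonal (a := e k + f k) (h.left j) ?_ ?_ ?_ ?_ ?_
  · rw [QuadraticMap.map_smul, h.left, smul_zero]
  · rw [polar_smul_left, h.left_left, smul_zero]
  · rw [map_add_eq, h.left, h.right, h.pair]; ring
  · rw [polar_add_left, h.left_left, polar_comm, h.left_right j k hkj.symm, add_zero]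
  · rw [polar_smul_right, polar_add_left, h.left_left, polar_comm, h.left_right i k hki.symm,
      add_zero, smul_zero]

lemma isEven_siegel_right (h : IsHyperbolicBasis N e f) (hι : ∀ i j : ι, ∃ k, k ≠ i ∧ k ≠ j)
    {j i : ι} (hij : j ≠ i) (t : F) : IsEven N (siegel N (e j) (t • f i)) := by
  obtain ⟨k, hki, hkj⟩ := hι i j
  refine isEven_siegel_of_orthogonal (a := e k + f k) (h.left j) ?_ ?_ ?_ ?_ ?_
  · rw [QuadraticMap.map_smul, h.right, smul_zero]
  · rw [polar_smul_left, polar_comm, h.left_right j i hij, smul_zero]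
  · rw [map_add_eq, h.left, h.right, h.pair]; ring
  · rw [polar_add_left, h.left_left, polar_comm, h.left_right j k hkj.symm, add_zero]
  · rw [polar_smul_right, polar_add_left, h.right_right, h.left_right k i hki, add_zero, smul_zero]

lemma isEven_siegel (h : IsHyperbolicBasis N e f) (hι : ∀ i j : ι, ∃ k, k ≠ i ∧ k ≠ j)
    (j : ι) {v : V} (hv : polar N v (e j) = 0) : IsEven N (siegel N (e j) v) := by
  suffices H : polar N v (e j) = 0 ∧ IsEven N (siegel N (e j) v) from H.2
  have key : ∀ v w, (polar N v (e j) = 0 ∧ IsEven N (siegel N (e j) v)) →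
      (polar N w (e j) = 0 ∧ IsEven N (siegel N (e j) w)) →
      (polar N (v + w) (e j) = 0 ∧ IsEven N (siegel N (e j) (v + w))) := fun v w h1 h2 =>
    ⟨by rw [polar_add_left, h1.1, h2.1, add_zero],
      isEven_siegel_add (h.left j) h1.1 h2.1 h1.2 h2.2⟩
  have hzero : polar N 0 (e j) = 0 ∧ IsEven N (siegel N (e j) 0) :=
    ⟨by simp, 1, one_mem _, fun x => by simp [siegel]⟩
  rw [h.sum v]
  refine Finset.sum_induction _ (fun v => polar N v (e j) = 0 ∧ IsEven N (siegel N (e j) v))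
    key hzero fun i _ => key _ _ ⟨?_, h.isEven_siegel_left hι j i _⟩ ?_
  · rw [polar_smul_left, h.left_left, smul_zero]
  · by_cases hij : j = i
    -- The only basis vector not orthogonal to `e j` is `f j`, and its coefficient in `v` is `⟨v, e
    -- j⟩ = 0`.
    · rw [← hij, hv, zero_smul]
      exact hzero
    · exact ⟨by rw [polar_smul_left, polar_comm N (f i), h.left_right j i hij, smul_zero],
        h.isEven_siegel_right hι hij _⟩

end IsHyperbolicBasis

/-! ### Moving singular vectors by reflections -/

/-- Two vectors are conjugate under the elements of the reflection group that fix all vectors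
orthogonal to `W`. -/
def Linked (N : QuadraticForm F V) (W : Submodule F V) (x y : V) : Prop :=
  ∃ r ∈ reflectionGroup N, (∀ p, (∀ w ∈ W, polar N w p = 0) → r.1 p = p) ∧ r.1 x = y

namespace Linked

variable {W : Submodule F V} {x y z : V}

lemma trans (h1 : Linked N W x y) (h2 : Linked N W y z) : Linked N W x z := by
  obtain ⟨r, hr, hp, hx⟩ := h1
  obtain ⟨s, hs, hq, hy⟩ := h2
  refine ⟨s * r, mul_mem hs hr, fun p h => ?_, ?_⟩
  · change s.1 (r.1 p) = p
    rw [hp p h, hq p h]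
  · change s.1 (r.1 x) = z
    rw [hx, hy]

/-- The value `-1` is the one for which `N (x - y) = 1`; the reflection in `x - y` then sends `x` to
`y`. -/
lemma of_polar_eq_neg_one (hx : x ∈ W) (hy : y ∈ W) (hNx : N x = 0) (hNy : N y = 0)
    (h : polar N x y = -1) : Linked N W x y := by
  have h1 : N (x - y) = 1 := by rw [map_sub_eq, hNx, hNy, h]; ring
  refine ⟨_, reflection_mem ⟨x - y, h1⟩, fun p hp => ?_, ?_⟩
  · rw [reflection_apply, hp _ (W.sub_mem hx hy), zero_smul, sub_zero]
  · rw [reflection_apply, polar_sub_left, polar_self', hNx, polar_comm N y, h]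
    module

/-- A multiple of `z` pairs to `-1` with both `x` and `y` and serves as an intermediate stop. -/
lemma of_common (hx : x ∈ W) (hy : y ∈ W) (hz : z ∈ W) (hNx : N x = 0) (hNy : N y = 0)
    (hNz : N z = 0) (h0 : polar N x z ≠ 0) (h : polar N y z = polar N x z) : Linked N W x y := by
  have hz' := W.smul_mem (-(polar N x z)⁻¹) hz
  have hNz' : N (-(polar N x z)⁻¹ • z) = 0 := by rw [QuadraticMap.map_smul, hNz, smul_zero]
  refine (of_polar_eq_neg_one hx hz' hNx hNz' ?_).trans
    (of_polar_eq_neg_one hz' hy hNz' hNy ?_)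
  · rw [polar_smul_right, smul_eq_mul]
    field_simp
  · rw [polar_smul_left, polar_comm N z, h, smul_eq_mul]
    field_simp

/-- Singular vectors in a space that contains two orthogonal hyperbolic pairs are linked. -/
lemma of_singular {e f e' f' : V} (he : e ∈ W) (hf : f ∈ W) (he' : e' ∈ W) (hf' : f' ∈ W)
    (hNe : N e = 0) (hNf : N f = 0) (hNe' : N e' = 0) (hNf' : N f' = 0)
    (hef : polar N e f = 1) (hef' : polar N e' f' = 1) (h1 : polar N e e' = 0)
    (h2 : polar N e f' = 0) (h3 : polar N e' f = 0) (h4 : polar N f f' = 0)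
    (hx : x ∈ W) (hNx : N x = 0) (hy : y ∈ W) (hxy : polar N x y = 1) : Linked N W x e := by
  have e'e : Linked N W e' e := by
    refine of_common (z := f + f') he' he (W.add_mem hf hf') hNe' hNe ?_ ?_ ?_
    · rw [map_add_eq, hNf, hNf', h4]; ring
    · simp [polar_add_right, h3, hef']
    · simp [polar_add_right, h2, h3, hef, hef']
  -- Through `f`, `x` is linked to a multiple of `e`. The scalar is then removed by a detour through
  -- `e'`, which is why a second hyperbolic pair is needed.
  have of_f : polar N x f ≠ 0 → Linked N W x e := fun h => by
    refine (of_common (y := polar N x f • e) hx (W.smul_mem _ he) hf hNx ?_ hNf h ?_).trans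
      (trans (y := e') ?_ e'e)
    · rw [QuadraticMap.map_smul, hNe, smul_zero]
    · rw [polar_smul_left, hef, smul_eq_mul, mul_one]
    · refine of_common (z := (polar N x f)⁻¹ • f + f') (W.smul_mem _ he) he'
        (W.add_mem (W.smul_mem _ hf) hf') ?_ hNe' ?_ ?_ ?_
      · rw [QuadraticMap.map_smul, hNe, smul_zero]
      · simp [QuadraticMap.map_add, QuadraticMap.map_smul, hNf, hNf', h4, polar_smul_left]
      · simp [polar_add_right, polar_smul_right, polar_smul_left, hef, h2, h]
      · simp [polar_add_right, polar_smul_right, polar_smul_left, hef, h2, h3, hef', h]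
  by_cases hxf : polar N x f = 0
  swap
  · exact of_f hxf
  by_cases hxe : polar N x e = 0
  swap
  · refine (of_common (y := polar N x e • f) hx (W.smul_mem _ hf) he hNx ?_ hNe hxe ?_).trans
      (trans (y := e') ?_ e'e)
    · rw [QuadraticMap.map_smul, hNf, smul_zero]
    · rw [polar_smul_left, polar_comm N f, hef, smul_eq_mul, mul_one]
    · refine of_common (z := (polar N x e)⁻¹ • e + f') (W.smul_mem _ hf) he'
        (W.add_mem (W.smul_mem _ he) hf') ?_ hNe' ?_ ?_ ?_
      · rw [QuadraticMap.map_smul, hNf, smul_zero]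
      · simp [QuadraticMap.map_add, QuadraticMap.map_smul, hNe, hNf', h2, polar_smul_left]
      · simp [polar_add_right, polar_smul_right, polar_smul_left, polar_comm N f e, hef, h4, hxe]
      · simp [polar_add_right, polar_smul_right, polar_smul_left, polar_comm N f e,
          polar_comm N e' e, hef, h4, h1, hef', hxe]
  -- Now `x` is orthogonal to `e` and `f`. Project `y` off their plane; subtracting `N y' • x` makes
  -- the result singular, and adding `f` makes it pair to 1 with both `x` and `e`.
  set y' := y - polar N y f • e - polar N y e • f with hy'
  have y'W : y' ∈ W := W.sub_mem (W.sub_mem hy (W.smul_mem _ he)) (W.smul_mem _ hf)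
  have hxy' : polar N x y' = 1 := by
    simp [hy', polar_sub_right, polar_smul_right, hxe, hxf, hxy]
  have hey' : polar N e y' = 0 := by
    simp [hy', polar_sub_right, polar_smul_right, hNe, hef, polar_comm N e y]
  have hfy' : polar N f y' = 0 := by
    simp [hy', hNf, hef, polar_comm N f]
  refine of_common (z := y' - N y' • x + f) hx he
    (W.add_mem (W.sub_mem y'W (W.smul_mem _ hx)) hf) hNx hNe ?_ ?_ ?_
  · clear_value y'
    simp [map_add_eq, map_sub_eq, QuadraticMap.map_smul, hNx, hNf, polar_sub_left,
      polar_smul_left, polar_comm N y', hxy', hfy', hxf]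
  · simp [polar_add_right, polar_sub_right, polar_smul_right, hNx, hxy', hxf]
  · simp [polar_add_right, polar_sub_right, polar_smul_right, hNx, hxy', hxf, hey',
      hef, polar_comm N e x, hxe]

end Linked

/-! ### The orthogonal group modulo reflections -/

namespace IsHyperbolicBasis

variable {ι : Type*} [Fintype ι] {e f : ι → V}

lemma ext_apply (h : IsHyperbolicBasis N e f) {g k : orthogonalGroup N}
    (he : ∀ i, g.1 (e i) = k.1 (e i)) (hf : ∀ i, g.1 (f i) = k.1 (f i)) : g = k := by
  refine Subtype.ext (LinearEquiv.ext fun x => ?_)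
  rw [h.sum x]
  simp only [map_sum, map_add, map_smul, he, hf]

/-- Pairs are straightened one at a time inside the orthogonal complement `W` of those already
fixed. The pair `o` is left out because it serves as the second hyperbolic pair of
`Linked.of_singular` at each step. -/
lemma exists_fixing (h : IsHyperbolicBasis N e f) (hι : ∀ i j : ι, ∃ k, k ≠ i ∧ k ≠ j) (o : ι)
    (g : orthogonalGroup N) (I : Finset ι) : o ∉ I → ∃ r ∈ reflectionGroup N,
      ∀ i ∈ I, (r * g).1 (e i) = e i ∧ (r * g).1 (f i) = f i := by
  classical
  induction I using Finset.induction_on with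
  | empty => exact fun _ => ⟨1, one_mem _, by simp⟩
  | insert j I hj ih =>
    intro ho
    rw [Finset.mem_insert, not_or] at ho
    obtain ⟨r, hr, hfix⟩ := ih ho.2
    set g' := r * g with hg'
    let W : Submodule F V :=
      { carrier := {w | ∀ i ∈ I, polar N w (e i) = 0 ∧ polar N w (f i) = 0}
        add_mem' := fun {v w} hv hw i hi => by
          simp [polar_add_left, hv i hi, hw i hi]
        zero_mem' := fun i _ => by simp
        smul_mem' := fun c w hw i hi => by simp [polar_smul_left, hw i hi] }
    have eW : ∀ k, k ∉ I → e k ∈ W := fun k hk i hi =>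
      ⟨h.left_left k i, h.left_right k i fun hki => hk (hki ▸ hi)⟩
    have fW : ∀ k, k ∉ I → f k ∈ W := fun k hk i hi =>
      ⟨by rw [polar_comm, h.left_right i k fun hki => hk (hki ▸ hi)], h.right_right k i⟩
    have gW : ∀ (g' : orthogonalGroup N), (∀ i ∈ I, g'.1 (e i) = e i ∧ g'.1 (f i) = f i) →
        ∀ w ∈ W, g'.1 w ∈ W := fun g' hfix w hw i hi => by
      constructor
      · rw [← (hfix i hi).1, polar_map, (hw i hi).1]
      · rw [← (hfix i hi).2, polar_map, (hw i hi).2]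
    have hNg : ∀ (g : orthogonalGroup N) x, N (g.1 x) = N x := fun g => g.2
    obtain ⟨s, hs, hsfix, hse⟩ := Linked.of_singular (W := W) (N := N) (x := g'.1 (e j))
      (y := g'.1 (f j)) (eW j hj) (fW j hj) (eW o ho.2) (fW o ho.2) (h.left j) (h.right j)
      (h.left o) (h.right o) (h.pair j) (h.pair o) (h.left_left j o)
      (h.left_right j o (Ne.symm ho.1)) (h.left_right o j ho.1) (h.right_right j o)
      (gW g' hfix _ (eW j hj)) (by rw [hNg, h.left]) (gW g' hfix _ (fW j hj))
      (by rw [polar_map, h.pair])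
    have hfix' : ∀ i ∈ I, (s * g').1 (e i) = e i ∧ (s * g').1 (f i) = f i := fun i hi => by
      constructor
      · change s.1 (g'.1 (e i)) = e i
        rw [(hfix i hi).1, hsfix _ fun w hw => (hw i hi).1]
      · change s.1 (g'.1 (f i)) = f i
        rw [(hfix i hi).2, hsfix _ fun w hw => (hw i hi).2]
    set w := (s * g').1 (f j) with hw
    have hse' : (s * g').1 (e j) = e j := hse
    have hew : polar N (e j) w = 1 := by
      rw [← hse', hw, polar_map, h.pair]
    have hwW : w ∈ W := gW _ hfix' _ (fW j hj)
    have hNw : N w = 0 := by rw [hw, hNg, h.right]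
    have hwe : polar N (w - f j) (e j) = 0 := by
      rw [polar_sub_left, polar_comm, hew, polar_comm, h.pair, sub_self]
    have hperp : ∀ p, polar N p (e j) = 0 → polar N p (w - f j) = 0 →
        siegel N (e j) (w - f j) p = p := fun p h1 h2 => by simp [siegel, h1, h2]
    -- Once `e j` is fixed, this Siegel transformation takes the image `w` of `f j` back to `f j`.
    -- It fixes `e j` and the earlier pairs, which are orthogonal to `e j` and `w - f j`.
    obtain ⟨q, hq, hqx⟩ := h.isEven_siegel hι j hwe
    refine ⟨q * s * r, mul_mem (mul_mem (even_le hq) hs) hr, fun i hi => ?_⟩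
    have happ : ∀ x, (q * s * r * g).1 x = siegel N (e j) (w - f j) ((s * g').1 x) :=
      fun x => hqx _
    rw [happ, happ]
    rcases Finset.mem_insert.1 hi with rfl | hi
    · rw [hse']
      refine ⟨hperp _ (h.left_left i i) (by rw [polar_comm, hwe]), ?_⟩
      rw [← hw]
      simp only [siegel, polar_sub_right, polar_self', hNw, polar_comm N w (e i), hew, map_sub_eq,
        h.right]
      module
    · have hv : w - f j ∈ W := W.sub_mem hwW (fW j hj)
      rw [(hfix' i hi).1, (hfix' i hi).2]
      refine ⟨hperp _ (h.left_left i j) (by rw [polar_comm, (hv i hi).1]),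
        hperp _ ?_ (by rw [polar_comm, (hv i hi).2])⟩
      rw [polar_comm, h.left_right j i fun hji => hj (hji ▸ hi)]

/-- Modulo reflections in vectors of norm one, every orthogonal transformation is a scaling of a
given hyperbolic pair. -/
lemma exists_scaling (h : IsHyperbolicBasis N e f) (hι : ∀ i j : ι, ∃ k, k ≠ i ∧ k ≠ j) (o : ι)
    (g : orthogonalGroup N) : ∃ r ∈ reflectionGroup N, ∃ c d : F,
      (∀ i, i ≠ o → (r * g).1 (e i) = e i ∧ (r * g).1 (f i) = f i) ∧
      (r * g).1 (e o) = c • e o ∧ (r * g).1 (f o) = d • f o := by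
  classical
  obtain ⟨r, hr, hfix⟩ := h.exists_fixing hι o g (Finset.univ.erase o) (by simp)
  replace hfix : ∀ i, i ≠ o → (r * g).1 (e i) = e i ∧ (r * g).1 (f i) = f i :=
    fun i hi => hfix i (by simp [hi])
  have expand : ∀ x, (∀ i, i ≠ o → polar N x (e i) = 0 ∧ polar N x (f i) = 0) →
      (r * g).1 x = polar N ((r * g).1 x) (f o) • e o + polar N ((r * g).1 x) (e o) • f o := by
    intro x hx
    conv_lhs => rw [h.sum ((r * g).1 x)]
    refine Finset.sum_eq_single o (fun i _ hi => ?_) (by simp)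
    rw [← (hfix i hi).1, ← (hfix i hi).2, polar_map, polar_map, (hx i hi).1, (hx i hi).2]
    simp
  have he := expand (e o) fun i hi => ⟨h.left_left o i, h.left_right o i hi.symm⟩
  have hf := expand (f o) fun i hi =>
    ⟨by rw [polar_comm, h.left_right i o hi], h.right_right o i⟩
  set k := r * g with hk
  set p := polar N (k.1 (e o)) (f o)
  set q := polar N (k.1 (e o)) (e o)
  set t := polar N (k.1 (f o)) (f o)
  set s := polar N (k.1 (f o)) (e o)
  have hNk : ∀ x, N (k.1 x) = N x := k.2
  have hN : ∀ a b : F, N (a • e o + b • f o) = a * b := fun a b => by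
    simp [QuadraticMap.map_add, QuadraticMap.map_smul, h.left, h.right, polar_smul_left,
      polar_smul_right, h.pair, mul_comm]
  have hpq : p * q = 0 := by rw [← hN, ← he, hNk, h.left]
  have hts : t * s = 0 := by rw [← hN, ← hf, hNk, h.right]
  have hone : p * s + q * t = 1 := by
    rw [← h.pair o, ← polar_map k, he, hf]
    simp [polar_add_left, polar_add_right, polar_smul_left, polar_smul_right, h.left,
      h.right, h.pair, polar_comm N (f o)]
    ring
  -- The singular vectors of the plane of `e o`, `f o` form two lines, so these are either swapped
  -- or preserved. A swap is undone by the reflection in `e o + f o`, which sends `e o` to `-f o`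
  -- and `f o` to `-e o`; hence the signs of `-q` and `-t`.
  rcases mul_eq_zero.1 hpq with hp | hq
  · have hs : s = 0 := by
      rcases mul_eq_zero.1 hts with ht | hs
      · rw [hp, ht] at hone; simp at hone
      · exact hs
    have h1 : N (e o + f o) = 1 := by
      rw [map_add_eq, h.left, h.right, h.pair]; ring
    refine ⟨reflection N ⟨_, h1⟩ * r, mul_mem (reflection_mem _) hr, -q, -t, fun i hi => ?_, ?_, ?_⟩
    · rw [mul_assoc, ← hk]
      change (reflection N ⟨_, h1⟩).1 (k.1 _) = _ ∧ (reflection N ⟨_, h1⟩).1 (k.1 _) = _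
      rw [(hfix i hi).1, (hfix i hi).2]
      simp [reflection_apply, polar_add_left, h.left_left, h.right_right,
        h.left_right o i hi.symm, polar_comm N (f o), h.left_right i o hi]
    · rw [mul_assoc, ← hk]
      change (reflection N ⟨_, h1⟩).1 (k.1 _) = _
      rw [he, hp, reflection_apply]
      simp only [polar_add_left, polar_smul_right, h.right_right, h.pair, zero_smul,
        zero_add, smul_eq_mul]
      module
    · rw [mul_assoc, ← hk]
      change (reflection N ⟨_, h1⟩).1 (k.1 _) = _
      rw [hf, hs, reflection_apply]
      simp only [polar_add_left, polar_smul_right, h.left_left, h.pair, zero_smul,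
        zero_add, add_zero, smul_eq_mul, polar_comm N (f o)]
      module
  · have ht : t = 0 := by
      rcases mul_eq_zero.1 hts with ht | ht
      · exact ht
      · rw [hq, ht] at hone; simp at hone
    exact ⟨r, hr, p, s, hfix, by rw [← hk, he, hq]; simp, by rw [← hk, hf, ht]; simp⟩

/-- All reflections have the same image modulo `E`, and conjugation permutes them, so this image is
central. What remains of two orthogonal maps is two scalings of the same pair, which commute. -/
lemma commutator_le_even (h : IsHyperbolicBasis N e f) (hι : ∀ i j : ι, ∃ k, k ≠ i ∧ k ≠ j)
    (o : ι) : commutator (orthogonalGroup N) ≤ evenReflectionGroup N := by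
  let π := QuotientGroup.mk' (evenReflectionGroup N)
  have hcen : ∀ r ∈ reflectionGroup N, ∀ g, Commute (π r) (π g) := fun r hr g => by
    induction hr using Subgroup.closure_induction with
    | mem r hr =>
      obtain ⟨a, rfl⟩ := hr
      have := reflection_mul_mem (restrictNormOne N g a) a
      rw [← QuotientGroup.eq_one_iff] at this
      have h1 : π (reflection N a) * π (reflection N a) = 1 := by
        rw [← map_mul, reflection_mul_self, map_one]
      have h2 : π (reflection N (restrictNormOne N g a)) * π (reflection N a) = 1 := this
      have h3 := congrArg π (mul_reflection g a)
      rw [map_mul, map_mul, mul_right_cancel (h2.trans h1.symm)] at h3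
      exact h3.symm
    | one => rw [map_one]; exact Commute.one_left _
    | mul r s _ _ hr hs => rw [map_mul]; exact hr.mul_left hs
    | inv r _ hr => rw [map_inv]; exact hr.inv_left
  refine Subgroup.commutator_le.2 fun g _ k _ => ?_
  obtain ⟨r, hr, c, d, h1, h2, h3⟩ := h.exists_scaling hι o g
  obtain ⟨s, hs, c', d', h1', h2', h3'⟩ := h.exists_scaling hι o k
  have hcomm : (r * g) * (s * k) = (s * k) * (r * g) := by
    refine h.ext_apply (fun i => ?_) fun i => ?_
    · change (r * g).1 ((s * k).1 (e i)) = (s * k).1 ((r * g).1 (e i))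
      by_cases hi : i = o
      · rw [hi, h2, h2', map_smul, map_smul, h2, h2', smul_comm]
      · rw [(h1 i hi).1, (h1' i hi).1, (h1 i hi).1]
    · change (r * g).1 ((s * k).1 (f i)) = (s * k).1 ((r * g).1 (f i))
      by_cases hi : i = o
      · rw [hi, h3, h3', map_smul, map_smul, h3, h3', smul_comm]
      · rw [(h1 i hi).2, (h1' i hi).2, (h1 i hi).2]
  have hg : g = r⁻¹ * (r * g) := by group
  have hk : k = s⁻¹ * (s * k) := by group
  have hgk : Commute (π g) (π k) := by
    rw [hg, map_mul π r⁻¹]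
    refine (hcen _ (inv_mem hr) _).mul_left ?_
    rw [hk, map_mul π s⁻¹]
    refine (hcen _ (inv_mem hs) _).symm.mul_right ?_
    change π _ * π _ = π _ * π _
    rw [← map_mul, hcomm, map_mul]
  refine (QuotientGroup.eq_one_iff _).1 ((map_commutatorElement π g k).trans ?_)
  exact commutatorElement_eq_one_iff_commute.2 hgk

end IsHyperbolicBasis

end QuadraticForm

/-! ### The norm of the Zorn algebra as a hyperbolic form -/

namespace Zorn

open QuadraticForm QuadraticMap

variable {F : Type*} [Field F]

lemma polar_apply (x y : Zorn F) :
    polar (norm F) x y = x.a * y.b + y.a * x.b - x.α ⬝ᵥ y.β - y.α ⬝ᵥ x.β := by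
  simp [polar, norm_apply]
  ring

lemma sub_def (x y : Zorn F) :
    x - y = ⟨x.a - y.a, x.α - y.α, x.β - y.β, x.b - y.b⟩ := by
  rw [sub_eq_add_neg]
  ext <;> simp [sub_eq_add_neg]

@[simp] lemma sub_a (x y : Zorn F) : (x - y).a = x.a - y.a := by rw [sub_def]
@[simp] lemma sub_α (x y : Zorn F) : (x - y).α = x.α - y.α := by rw [sub_def]
@[simp] lemma sub_β (x y : Zorn F) : (x - y).β = x.β - y.β := by rw [sub_def]
@[simp] lemma sub_b (x y : Zorn F) : (x - y).b = x.b - y.b := by rw [sub_def]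

variable (F) in
/-- The first halves of the standard hyperbolic pairs. -/
def leftBasis : Fin 4 → Zorn F :=
  ![⟨1, 0, 0, 0⟩, ⟨0, ![1, 0, 0], 0, 0⟩, ⟨0, ![0, 1, 0], 0, 0⟩, ⟨0, ![0, 0, 1], 0, 0⟩]

variable (F) in
/-- The second halves of the standard hyperbolic pairs. -/
def rightBasis : Fin 4 → Zorn F :=
  ![⟨0, 0, 0, 1⟩, ⟨0, 0, ![-1, 0, 0], 0⟩, ⟨0, 0, ![0, -1, 0], 0⟩, ⟨0, 0, ![0, 0, -1], 0⟩]

/-- The signs in `rightBasis` compensate for the minus sign in `N x = a b - α · β`. -/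
lemma isHyperbolicBasis : IsHyperbolicBasis (norm F) (leftBasis F) (rightBasis F) where
  left i := by fin_cases i <;> simp [leftBasis, norm_apply]
  right i := by fin_cases i <;> simp [rightBasis, norm_apply]
  left_left i j := by
    fin_cases i <;> fin_cases j <;> rw [polar_apply] <;> simp [leftBasis]
  right_right i j := by
    fin_cases i <;> fin_cases j <;> rw [polar_apply] <;> simp [rightBasis]
  pair i := by
    fin_cases i <;> simp [leftBasis, rightBasis, polar_apply]
  left_right i j hij := by
    fin_cases i <;> fin_cases j <;>
      first | exact absurd rfl hij | simp [leftBasis, rightBasis, polar_apply]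
  sum x := by
    ext i <;> (try fin_cases i) <;>
      simp [Fin.sum_univ_four, leftBasis, rightBasis, polar_apply, Matrix.vec3_dotProduct]

lemma exists_ne_ne (i j : Fin 4) : ∃ k, k ≠ i ∧ k ≠ j := by
  revert i j
  decide

lemma commutator_le_even : commutator (orthogonalGroup (norm F)) ≤ evenReflectionGroup (norm F) :=
  isHyperbolicBasis.commutator_le_even exists_ne_ne 0

lemma mul_add' (x y z : Zorn F) : x * (y + z) = x * y + x * z := by
  ext i <;> (try fin_cases i) <;>
    simp [Matrix.vec3_dotProduct, cross_zero', cross_one', cross_two'] <;> ring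

lemma add_mul' (x y z : Zorn F) : (x + y) * z = x * z + y * z := by
  ext i <;> (try fin_cases i) <;>
    simp [Matrix.vec3_dotProduct, cross_zero', cross_one', cross_two'] <;> ring

lemma mul_smul' (c : F) (x y : Zorn F) : x * (c • y) = c • (x * y) := by
  ext i <;> (try fin_cases i) <;>
    simp [Matrix.vec3_dotProduct, cross_zero', cross_one', cross_two'] <;> ring

lemma smul_mul' (c : F) (x y : Zorn F) : (c • x) * y = c • (x * y) := by
  ext i <;> (try fin_cases i) <;>
    simp [Matrix.vec3_dotProduct, cross_zero', cross_one', cross_two'] <;> ring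

/-! ### Multiplications and reflections -/

/-- Left multiplication by an element of norm one. -/
def leftMul (a : NormOne F) : orthogonalGroup (norm F) where
  val :=
    { toFun := fun x => a.1 * x
      invFun := fun x => conj a.1 * x
      map_add' := mul_add' _
      map_smul' := fun c x => mul_smul' c _ x
      left_inv := fun x => (conj_mul_mul _ _).trans (by rw [a.2, one_smul])
      right_inv := fun x => (mul_conj_mul _ _).trans (by rw [a.2, one_smul]) }
  property x := by
    change norm F (a.1 * x) = norm F x
    rw [norm_mul, a.2, one_mul]

/-- Right multiplication by an element of norm one. -/
def rightMul (a : NormOne F) : orthogonalGroup (norm F) where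
  val :=
    { toFun := fun x => x * a.1
      invFun := fun x => x * conj a.1
      map_add' := fun x y => add_mul' x y _
      map_smul' := fun c x => smul_mul' c x _
      left_inv := fun x => (mul_mul_conj _ _).trans (by rw [a.2, one_smul])
      right_inv := fun x => (mul_conj_mul' _ _).trans (by rw [a.2, one_smul]) }
  property x := by
    change norm F (x * a.1) = norm F x
    rw [norm_mul, a.2, mul_one]

lemma orthogonal_ext {g h : orthogonalGroup (norm F)} (H : ∀ x, g.1 x = h.1 x) : g = h :=
  Subtype.ext (LinearEquiv.ext H)

/-- This is `a (conj x) + x (conj a) = ⟨a, x⟩ 1` multiplied by `a` on the right. For `N a = 1` the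
left side is the reflection in `a`. -/
lemma norm_smul_sub_polar_smul (a x : Zorn F) :
    norm F a • x - polar (norm F) a x • a = -((a * conj x) * a) := by
  ext i <;> (try fin_cases i) <;>
    simp [polar_apply, norm_apply, conj, Matrix.vec3_dotProduct, cross_zero', cross_one',
      cross_two'] <;> ring

lemma normOne_reflection_apply (a : NormOne F) (x : Zorn F) :
    (reflection (norm F) a).1 x = -((a.1 * conj x) * a.1) := by
  rw [← norm_smul_sub_polar_smul, a.2, one_smul, reflection_apply]

lemma conj_neg (x : Zorn F) : conj (-x) = -conj x := by
  ext <;> simp [conj]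

lemma conj_conj (x : Zorn F) : conj (conj x) = x := by
  ext <;> simp [conj]

lemma conj_mul (x y : Zorn F) : conj (x * y) = conj y * conj x := by
  ext i <;> (try fin_cases i) <;>
    simp [conj, Matrix.vec3_dotProduct, cross_zero', cross_one', cross_two'] <;> ring

lemma neg_mul' (x y : Zorn F) : -x * y = -(x * y) := by
  ext i <;> (try fin_cases i) <;> simp [cross_zero', cross_one', cross_two'] <;> ring

lemma mul_neg' (x y : Zorn F) : x * -y = -(x * y) := by
  ext i <;> (try fin_cases i) <;> simp [cross_zero', cross_one', cross_two'] <;> ring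

lemma flexible (x y : Zorn F) : x * (y * x) = (x * y) * x := by
  ext i <;> (try fin_cases i) <;>
    simp [Matrix.vec3_dotProduct, cross_zero', cross_one', cross_two'] <;> ring

/-- The middle Moufang identity. -/
lemma moufang (x y z : Zorn F) : x * ((y * z) * x) = (x * y) * (z * x) := by
  ext i <;> (try fin_cases i) <;>
    simp [Matrix.vec3_dotProduct, cross_zero', cross_one', cross_two'] <;> ring

lemma reflection_one_apply (x : Zorn F) : (reflection (norm F) (1 : NormOne F)).1 x = -conj x := by
  rw [normOne_reflection_apply]
  exact congrArg _ ((mul_one' _).trans (one_mul' _))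

lemma reflection_mul_reflection_one (a : NormOne F) :
    reflection (norm F) a * reflection (norm F) 1 = leftMul a * rightMul a := by
  refine orthogonal_ext fun x => ?_
  change (reflection (norm F) a).1 ((reflection (norm F) 1).1 x) = a.1 * (x * a.1)
  rw [reflection_one_apply, normOne_reflection_apply, conj_neg, conj_conj, mul_neg',
    neg_mul', neg_neg, flexible]

variable (F) in
/-- The group generated by the left and right multiplications with elements of norm one. -/
def multiplicationGroup : Subgroup (orthogonalGroup (norm F)) :=
  Subgroup.closure (Set.range leftMul ∪ Set.range rightMul)

lemma even_le_multiplicationGroup : evenReflectionGroup (norm F) ≤ multiplicationGroup F := by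
  have key : ∀ a : NormOne F, reflection (norm F) a * reflection (norm F) 1 ∈
      multiplicationGroup F := fun a => by
    rw [reflection_mul_reflection_one]
    exact mul_mem (Subgroup.subset_closure (Or.inl ⟨a, rfl⟩))
      (Subgroup.subset_closure (Or.inr ⟨a, rfl⟩))
  refine (Subgroup.closure_le _).2 ?_
  rintro _ ⟨a, b, rfl⟩
  -- `s_a s_b = (s_a s_1) (s_b s_1)⁻¹`.
  have h := mul_mem (key a) (inv_mem (key b))
  rwa [mul_inv_rev, reflection_inv, mul_assoc, ← mul_assoc (reflection _ 1),
    reflection_inv, reflection_mul_self, one_mul] at h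

/-- Since `L_a` sends 1 to `a`, it conjugates `s_1` to `s_a`, so `s_a s_1 = [L_a, s_1]`. -/
lemma even_le_commutator :
    evenReflectionGroup (norm F) ≤ commutator (orthogonalGroup (norm F)) := by
  have key : ∀ a : NormOne F, reflection (norm F) a * reflection (norm F) 1 ∈
      commutator (orthogonalGroup (norm F)) := fun a => by
    have h := Subgroup.commutator_mem_commutator (Subgroup.mem_top (leftMul a))
      (Subgroup.mem_top (reflection (norm F) 1))
    have ha : restrictNormOne (norm F) (leftMul a) 1 = a := Subtype.ext (mul_one' a.1)
    rw [commutatorElement_def, conj_reflection, reflection_inv, ha] at h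
    exact h
  refine (Subgroup.closure_le _).2 ?_
  rintro _ ⟨a, b, rfl⟩
  have h := mul_mem (key a) (inv_mem (key b))
  rwa [mul_inv_rev, reflection_inv, mul_assoc, ← mul_assoc (reflection _ 1),
    reflection_inv, reflection_mul_self, one_mul] at h

/-- The conjugate of an element of norm one. -/
def conjNormOne (a : NormOne F) : NormOne F := ⟨conj a.1, by rw [norm_conj, a.2]⟩

lemma leftMul_inv (a : NormOne F) : (leftMul a)⁻¹ = leftMul (conjNormOne a) :=
  orthogonal_ext fun _ => rfl

/-- Up to sign, `s_1` is conjugation, an anti-automorphism, so it exchanges left and right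
multiplications. -/
lemma rightMul_eq (a : NormOne F) : rightMul a =
    reflection (norm F) 1 * (leftMul a)⁻¹ * (reflection (norm F) 1)⁻¹ := by
  rw [leftMul_inv, reflection_inv]
  refine orthogonal_ext fun x => ?_
  change x * a.1 = (reflection (norm F) 1).1 (conj a.1 * (reflection (norm F) 1).1 x)
  rw [reflection_one_apply, reflection_one_apply, mul_neg', conj_neg, conj_mul, conj_conj,
    conj_conj, neg_neg]

lemma rightMul_mem {a : NormOne F} (h : leftMul a ∈ evenReflectionGroup (norm F)) :
    rightMul a ∈ evenReflectionGroup (norm F) := by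
  rw [rightMul_eq]
  exact evenReflectionGroup_normal.conj_mem _ (inv_mem h) _

lemma leftMul_mul (a b : NormOne F) :
    leftMul (a * b) = leftMul a * rightMul a * leftMul b * (rightMul a)⁻¹ := by
  rw [eq_mul_inv_iff_mul_eq]
  exact orthogonal_ext fun x => (moufang a.1 b.1 x).symm

/-- This allows `b` to be simplified by left factors already known to be good, as in Gaussian
elimination, despite the lack of associativity. -/
lemma leftMul_mem_of_mul {a b : NormOne F} (ha : leftMul a ∈ evenReflectionGroup (norm F))
    (hab : leftMul (a * b) ∈ evenReflectionGroup (norm F)) :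
    leftMul b ∈ evenReflectionGroup (norm F) := by
  rw [leftMul_mul] at hab
  have h := mul_mem (mul_mem (inv_mem (mul_mem ha (rightMul_mem ha))) hab) (rightMul_mem ha)
  rwa [show (leftMul a * rightMul a)⁻¹ * (leftMul a * rightMul a * leftMul b * (rightMul a)⁻¹) *
    rightMul a = leftMul b by group] at h

/-! ### Left multiplications are even products of reflections -/

/-- Upper unitriangular vector matrices. -/
def upper (v : Fin 3 → F) : NormOne F := ⟨⟨1, v, 0, 1⟩, by simp [norm_apply]⟩

/-- Lower unitriangular vector matrices. -/
def lower (v : Fin 3 → F) : NormOne F := ⟨⟨1, 0, v, 1⟩, by simp [norm_apply]⟩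

/-- The automorphism that interchanges upper and lower vectors. -/
def swap : orthogonalGroup (norm F) where
  val :=
    { toFun := fun x => ⟨x.b, -x.β, -x.α, x.a⟩
      invFun := fun x => ⟨x.b, -x.β, -x.α, x.a⟩
      map_add' := fun x y => by ext <;> simp <;> ring
      map_smul' := fun c x => by ext <;> simp
      left_inv := fun x => by ext <;> simp
      right_inv := fun x => by ext <;> simp }
  property x := by
    change x.b * x.a - -x.β ⬝ᵥ -x.α = x.a * x.b - x.α ⬝ᵥ x.β
    rw [neg_dotProduct_neg, dotProduct_comm, mul_comm]

lemma swap_mul (x y : Zorn F) : (swap (F := F)).1 (x * y) = swap.1 x * swap.1 y := by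
  change (⟨_, _, _, _⟩ : Zorn F) = ⟨_, _, _, _⟩ * ⟨_, _, _, _⟩
  ext i <;> (try fin_cases i) <;>
    simp [Matrix.vec3_dotProduct, cross_zero', cross_one', cross_two'] <;> ring

lemma leftMul_upper_mem (v : Fin 3 → F) : leftMul (upper v) ∈ evenReflectionGroup (norm F) := by
  -- `L_{upper v}` sends `(c, γ, δ, d)` to `(c + v · δ, γ + d v, δ + v × γ, d)`. The first two
  -- changes are `p⁻¹`. The skew map `γ ↦ v × γ` splits into the terms with `v 1`, `v 2`, given by
  -- `q`, and those with `v 0`, given by `r`.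
  obtain ⟨p, hp, h1⟩ := isHyperbolicBasis.isEven_siegel (F := F) exists_ne_ne 0
    (v := ⟨0, v, 0, 0⟩) (by simp [polar_apply, leftBasis])
  obtain ⟨q, hq, h2⟩ := isHyperbolicBasis.symm.isEven_siegel (F := F) exists_ne_ne 1
    (v := ⟨0, 0, ![0, -v 2, v 1], 0⟩) (by simp [polar_apply, rightBasis])
  obtain ⟨r, hr, h3⟩ := isHyperbolicBasis.symm.isEven_siegel (F := F) exists_ne_ne 2
    (v := ⟨0, 0, ![0, 0, -v 0], 0⟩) (by simp [polar_apply, rightBasis])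
  have h : leftMul (upper v) = p⁻¹ * q * r := by
    rw [mul_assoc, eq_inv_mul_iff_mul_eq]
    refine orthogonal_ext fun x => ?_
    change p.1 ((upper v).1 * x) = q.1 (r.1 x)
    rw [h1, h2, h3]
    ext i <;> (try fin_cases i) <;>
      simp [siegel, upper, leftBasis, rightBasis, polar_apply, norm_apply, Matrix.vec3_dotProduct,
        Matrix.vecHead, Matrix.vecTail, cross_zero', cross_one', cross_two'] <;> ring
  rw [h]
  exact mul_mem (mul_mem (inv_mem hp) hq) hr

lemma leftMul_lower_mem (v : Fin 3 → F) : leftMul (lower v) ∈ evenReflectionGroup (norm F) := by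
  have h : leftMul (lower v) = swap * leftMul (upper (-v)) * swap⁻¹ := by
    rw [eq_mul_inv_iff_mul_eq]
    refine orthogonal_ext fun x => ?_
    change (lower v).1 * swap.1 x = swap.1 ((upper (-v)).1 * x)
    rw [swap_mul]
    congr 1
    change (⟨1, 0, v, 1⟩ : Zorn F) = ⟨1, -0, - -v, 1⟩
    simp
  rw [h]
  exact evenReflectionGroup_normal.conj_mem _ (leftMul_upper_mem _) _

/-- An upper unitriangular factor clears `α` and keeps `b = 1`; norm one then forces `a = 1`,
leaving a lower unitriangular matrix. -/
lemma leftMul_mem_of_b_eq_one {x : NormOne F} (hx : x.1.b = 1) :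
    leftMul x ∈ evenReflectionGroup (norm F) := by
  refine leftMul_mem_of_mul (leftMul_upper_mem (-x.1.α)) ?_
  have hN := (upper (-x.1.α) * x).2
  have hα : (upper (-x.1.α) * x).1.α = 0 := by
    change (1 : F) • x.1.α + x.1.b • (-x.1.α) - 0 ⨯₃ x.1.β = 0
    simp [hx]
  have hb : (upper (-x.1.α) * x).1.b = 1 := by
    change 0 ⬝ᵥ x.1.α + 1 * x.1.b = 1
    simp [hx]
  rw [norm_apply, hα, hb, mul_one, zero_dotProduct, sub_zero] at hN
  rw [show upper (-x.1.α) * x = lower (upper (-x.1.α) * x).1.β from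
    Subtype.ext (Zorn.ext hN hα rfl hb)]
  exact leftMul_lower_mem _

lemma leftMul_mem_of_α_ne_zero {x : NormOne F} (hx : x.1.α ≠ 0) :
    leftMul x ∈ evenReflectionGroup (norm F) := by
  obtain ⟨i, hi⟩ := Function.ne_iff.1 hx
  -- A lower factor with vector `w` replaces `b` by `w · α + b`; here `w · α = 1 - b`.
  refine leftMul_mem_of_mul
    (leftMul_lower_mem (Pi.single i ((1 - x.1.b) * (x.1.α i)⁻¹))) (leftMul_mem_of_b_eq_one ?_)
  change Pi.single i _ ⬝ᵥ x.1.α + 1 * x.1.b = 1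
  rw [single_dotProduct, inv_mul_cancel_right₀ hi]
  ring

lemma leftMul_mem (x : NormOne F) : leftMul x ∈ evenReflectionGroup (norm F) := by
  by_cases hx : x.1.α = 0
  -- If `α = 0` then `a b = 1`, so `b ≠ 0` and the new upper vector `b • ![1, 0, 0]` is nonzero.
  · refine leftMul_mem_of_mul (leftMul_upper_mem ![1, 0, 0]) (leftMul_mem_of_α_ne_zero ?_)
    change (1 : F) • x.1.α + x.1.b • ![1, 0, 0] - 0 ⨯₃ x.1.β ≠ 0
    have hb : x.1.b ≠ 0 := fun hb => by
      have := x.2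
      simp [norm_apply, hx, hb] at this
    intro h
    have := congrFun h 0
    simp [hx, hb] at this
  · exact leftMul_mem_of_α_ne_zero hx

lemma multiplicationGroup_eq : multiplicationGroup F = commutator (orthogonalGroup (norm F)) := by
  refine le_antisymm (((Subgroup.closure_le _).2 ?_).trans even_le_commutator)
    (commutator_le_even.trans even_le_multiplicationGroup)
  rintro _ (⟨a, rfl⟩ | ⟨a, rfl⟩)
  · exact leftMul_mem a
  · exact rightMul_mem (leftMul_mem a)

/-! ### Faithfulness on the loop and the comparison of the groups -/

/-- The elements of norm one span the algebra. -/
lemma restrictNormOne_injective : Function.Injective (restrictNormOne (norm F)) := by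
  intro g h hgh
  have key : ∀ x : NormOne F, g.1 x.1 = h.1 x.1 := fun x =>
    congrArg Subtype.val (congrArg (fun p : Equiv.Perm _ => p x) hgh)
  have upper_eq : ∀ v, g.1 ⟨0, v, 0, 0⟩ = h.1 ⟨0, v, 0, 0⟩ := fun v => by
    have e : (⟨0, v, 0, 0⟩ : Zorn F) = (upper v).1 - (1 : NormOne F).1 := by
      change _ = (⟨1, v, 0, 1⟩ : Zorn F) - 1
      ext <;> simp
    rw [e, map_sub, map_sub, key, key]
  have lower_eq : ∀ v, g.1 ⟨0, 0, v, 0⟩ = h.1 ⟨0, 0, v, 0⟩ := fun v => by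
    have e : (⟨0, 0, v, 0⟩ : Zorn F) = (lower v).1 - (1 : NormOne F).1 := by
      change _ = (⟨1, 0, v, 1⟩ : Zorn F) - 1
      ext <;> simp
    rw [e, map_sub, map_sub, key, key]
  have a_eq : g.1 ⟨1, 0, 0, 0⟩ = h.1 ⟨1, 0, 0, 0⟩ := by
    -- Over the field of two elements 1 is the only diagonal element of norm one, so a non-diagonal
    -- one is used to separate the two idempotents.
    have hN : norm F ⟨1, ![1, 0, 0], ![-1, 0, 0], 0⟩ = 1 := by simp [norm_apply]
    have e : (⟨1, 0, 0, 0⟩ : Zorn F) = ⟨1, ![1, 0, 0], ![-1, 0, 0], 0⟩ - ⟨0, ![1, 0, 0], 0, 0⟩ -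
        ⟨0, 0, ![-1, 0, 0], 0⟩ := by
      ext <;> simp
    rw [e, map_sub, map_sub, map_sub, map_sub, upper_eq, lower_eq, key ⟨_, hN⟩]
  have b_eq : g.1 ⟨0, 0, 0, 1⟩ = h.1 ⟨0, 0, 0, 1⟩ := by
    have e : (⟨0, 0, 0, 1⟩ : Zorn F) = (1 : NormOne F).1 - ⟨1, 0, 0, 0⟩ := by
      change _ = (1 : Zorn F) - _
      ext <;> simp
    rw [e, map_sub, map_sub, key, a_eq]
  refine isHyperbolicBasis.ext_apply (fun i => ?_) fun i => ?_
  · fin_cases i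
    exacts [a_eq, upper_eq _, upper_eq _, upper_eq _]
  · fin_cases i
    exacts [b_eq, lower_eq _, lower_eq _, lower_eq _]

lemma map_multiplicationGroup : (multiplicationGroup F).map (restrictNormOne (norm F)) =
    AlgLoop.multiplicationGroup (NormOne F) := by
  rw [multiplicationGroup, MonoidHom.map_closure, Set.image_union, ← Set.range_comp,
    ← Set.range_comp]
  have hl : restrictNormOne (norm F) ∘ leftMul = AlgLoop.leftTranslation :=
    funext fun a => Equiv.ext fun x => rfl
  have hr : restrictNormOne (norm F) ∘ rightMul = AlgLoop.rightTranslation :=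
    funext fun a => Equiv.ext fun x => rfl
  rw [hl, hr]
  rfl

end Zorn

theorem mainTheorem3 (F : Type*) [Field F] :
    Function.Injective (QuadraticForm.restrictNormOne (Zorn.norm F)) ∧
      AlgLoop.multiplicationGroup (Zorn.NormOne F) =
        (QuadraticForm.omegaGroup (Zorn.norm F)).map
          (QuadraticForm.restrictNormOne (Zorn.norm F)) :=
  ⟨Zorn.restrictNormOne_injective, by
    rw [QuadraticForm.omegaGroup, ← Zorn.multiplicationGroup_eq, Zorn.map_multiplicationGroup]⟩
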